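/- Let $G=(V,E)$ be a finite directed graph without self-loops on $n\ge 2$ nodes, with weights $\alpha_{ij}>0$ for $ij\in E$, and let $\mathcal N_i=\{j : ij\in E\}$. Let $L$ be the Laplacian, $L_{ii}=\sum_{j\in\mathcal N_i}\alpha_{ij}$, $L_{ij}=-\alpha_{ij}$ if $ij\in E$, and $L_{ij}=0$ otherwise. Call $G$ connected if it has a directed spanning tree, i.e. some node can be reached from every node along directed edges. Let $r_i>0$ $(i\in V)$, $R=\operatorname{diag}(r_i)$, $\tau>0$, $t_0,\kappa_1,\kappa_2,p\in\mathbb R$, $t_k=t_0+k\tau$, and consider the iteration $z_{k+1}=Az_k$ for $z_k=(x(t_k),s(t_k),y(t_k))\in\mathbb R^{3n}$, where $$A=\begin{pmatrix} I & \tau R & 0\\ -\kappa_1 L & I & -\kappa_2 I\\ -pL & 0 & (1-p)I\end{pmatrix},$$ i.e. $x_i(t_{k+1})=x_i(t_k)+\tau r_i s_i(t_k)$, $s_i(t_{k+1})=s_i(t_k)+\kappa_1\sum_{j\in\mathcal N_i}\alpha_{ij}(x_j(t_k)-x_i(t_k))-\kappa_2y_i(t_k)$, $y_i(t_{k+1})=p\sum_{j\in\mathcal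 N_i}\alpha_{ij}(x_j(t_k)-x_i(t_k))+(1-p)y_i(t_k)$. Say that a trajectory synchronizes to $(r^*,x^*)$ if $x_i(t_k)-r^*(t_k-t_0)\to x^*$ as $k\to\infty$ for every $i\in V$, and that the system synchronizes if for every initial condition $z_0\in\mathbb R^{3n}$ there are real numbers $r^*,x^*$ (depending on $z_0$) to which the trajectory synchronizes. Then the system synchronizes if and only if $G$ is connected, $\kappa_1\ne\kappa_2$, $p>0$, and every eigenvalue $\mu\in\mathbb C$ of $A$ with $\mu\neq1$ satisfies $|\mu|<1$. Moreover, if the system synchronizes, then there is a unique $\xi\in\mathbb R^n$ with $\xi^TL=0$ and $\sum_i\xi_i=1$; it satisfies $\xi_i\ge0$ for all $i$ and $\sum_i\xi_i/r_i>0$. With $\gamma$ the $\xi$-weighted harmonic mean of the $r_i$, $\frac1\gamma=\sum_i\frac{\xi_i}{r_i}$, the values $r^*,x^*$ are for every initial condition uniquely determined and given by $$x^*=\gamma\sum_{i}\xi_i\Bigl(\frac1{r_i}x_i(t_0)+\tau\frac{\kappa_2}{p^2}y_i(t_0)\Bigr),\qquad r^*=\gamma\sum_i\xi_i\Bigl(s_i(t_0)-\frac{\kappa_2}{p}y_i(t_0)\Bigr).$$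 -/

import Mathlib

open Filter Topology Matrix

namespace ClockSync

/-- The set `N_i` of neighbours of `i`: the nodes `j` with a directed edge `ij`, that is, the nodes
with respect to which `i` can measure its offset. -/
noncomputable def neighbors {V : Type*} [Fintype V] (G : Digraph V) (i : V) : Finset V :=
  open Classical in Finset.univ.filter fun j => G.Adj i j

/-- A directed graph is connected if it has a directed spanning tree: some node (the root) can be
reached from every node along directed edges. -/
def Connected {V : Type*} (G : Digraph V) : Prop :=
  ∃ root : V, ∀ i : V, Relation.ReflTransGen G.Adj i root

/-- The Laplacian matrix of the directed graph `G` with weights `α i j` on the edges `ij`.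
The values of `α` off the edges play no role. -/
noncomputable def laplacian {V : Type*} [Fintype V] [DecidableEq V] (G : Digraph V)
    (α : V → V → ℝ) : Matrix V V ℝ :=
  open Classical in
  Matrix.of fun i j =>
    if i = j then ∑ k ∈ neighbors G i, α i k else if G.Adj i j then -α i j else 0

/-- The `3n × 3n` system matrix, in `n × n` blocks
`[[I, τ R, 0], [-κ₁ L, I, -κ₂ I], [p (-L), 0, (1 - p) I]]` with `R = diag(r)`. -/
noncomputable def systemMatrix {V : Type*} [Fintype V] [DecidableEq V] (G : Digraph V)
    (α : V → V → ℝ) (r : V → ℝ) (τ κ₁ κ₂ p : ℝ) : Matrix (V ⊕ (V ⊕ V)) (V ⊕ (V ⊕ V)) ℝ :=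
  Matrix.fromBlocks
    1 (Matrix.fromCols (τ • Matrix.diagonal r) 0)
    (Matrix.fromRows (-(κ₁ • laplacian G α)) (p • (-laplacian G α)))
    (Matrix.fromBlocks 1 (-(κ₂ • (1 : Matrix V V ℝ))) 0 ((1 - p) • (1 : Matrix V V ℝ)))

/-- The clock `x_i` in the state `z = (x, s, y)`. -/
def clock {V : Type*} (z : V ⊕ (V ⊕ V) → ℝ) (i : V) : ℝ := z (Sum.inl i)

/-- The skew correction `s_i` in the state `z = (x, s, y)`. -/
def skew {V : Type*} (z : V ⊕ (V ⊕ V) → ℝ) (i : V) : ℝ := z (Sum.inr (Sum.inl i))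

/-- The moving average `y_i` in the state `z = (x, s, y)`. -/
def avg {V : Type*} (z : V ⊕ (V ⊕ V) → ℝ) (i : V) : ℝ := z (Sum.inr (Sum.inr i))

/-- `z` solves `z_{k+1} = A z_k`; the initial condition `z 0` is free. -/
def IsTrajectory {V : Type*} [Fintype V] [DecidableEq V] (G : Digraph V)
    (α : V → V → ℝ) (r : V → ℝ) (τ κ₁ κ₂ p : ℝ) (z : ℕ → V ⊕ (V ⊕ V) → ℝ) : Prop :=
  ∀ k : ℕ, z (k + 1) = systemMatrix G α r τ κ₁ κ₂ p *ᵥ z k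

/-- The update times `t_k = t₀ + k τ`. -/
def time (t₀ τ : ℝ) (k : ℕ) : ℝ := t₀ + k * τ

/-- Every clock approaches the line `rs * (t_k - t₀) + xs`. -/
def SynchronizesTo {V : Type*} (t₀ τ : ℝ) (z : ℕ → V ⊕ (V ⊕ V) → ℝ) (rs xs : ℝ) : Prop :=
  ∀ i : V, Tendsto (fun k : ℕ => clock (z k) i - rs * (time t₀ τ k - t₀)) atTop (𝓝 xs)

/-- The system synchronizes for all initial conditions (the limiting line may depend on the
initial condition). -/
def Synchronizes {V : Type*} [Fintype V] [DecidableEq V] (G : Digraph V)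
    (α : V → V → ℝ) (r : V → ℝ) (t₀ τ κ₁ κ₂ p : ℝ) : Prop :=
  ∀ z : ℕ → V ⊕ (V ⊕ V) → ℝ, IsTrajectory G α r τ κ₁ κ₂ p z →
    ∃ rs xs : ℝ, SynchronizesTo t₀ τ z rs xs

/-- The `w`-weighted harmonic mean of the `r i`: `1 / γ = ∑ i, w i / r i`. -/
noncomputable def harmonicMean {V : Type*} [Fintype V] (w r : V → ℝ) : ℝ :=
  1 / ∑ i, w i / r i

theorem laplacian_mulVec {V : Type*} [Fintype V] [DecidableEq V] (G : Digraph V)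
    (hG : ∀ i, ¬ G.Adj i i) (α : V → V → ℝ) (x : V → ℝ) (i : V) :
    (laplacian G α *ᵥ x) i = -∑ j ∈ neighbors G i, α i j * (x j - x i) := by
  classical
  have h : ∀ j, laplacian G α i j * x j
      = (if i = j then (∑ k ∈ neighbors G i, α i k) * x i else 0)
        - (if G.Adj i j then α i j * x j else 0) := by
    intro j
    by_cases hij : i = j
    · subst hij
      simp [laplacian, hG]
    · by_cases ha : G.Adj i j <;> simp [laplacian, hij, ha]
  simp only [Matrix.mulVec, dotProduct, h, Finset.sum_sub_distrib, Finset.sum_ite_eq,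
    Finset.mem_univ, if_true, mul_sub, ← Finset.sum_filter, Finset.sum_mul]
  simp [neighbors]

/-- The iteration `z_{k+1} = A z_k` is the node-wise update rule of the algorithm. -/
theorem isTrajectory_iff {V : Type*} [Fintype V] [DecidableEq V] (G : Digraph V)
    (hG : ∀ i, ¬ G.Adj i i) (α : V → V → ℝ) (r : V → ℝ) (τ κ₁ κ₂ p : ℝ)
    (z : ℕ → V ⊕ (V ⊕ V) → ℝ) :
    IsTrajectory G α r τ κ₁ κ₂ p z ↔ ∀ (k : ℕ) (i : V),
      clock (z (k + 1)) i = clock (z k) i + τ * r i * skew (z k) i ∧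
      skew (z (k + 1)) i = skew (z k) i
        + κ₁ * ∑ j ∈ neighbors G i, α i j * (clock (z k) j - clock (z k) i)
        - κ₂ * avg (z k) i ∧
      avg (z (k + 1)) i = p * ∑ j ∈ neighbors G i, α i j * (clock (z k) j - clock (z k) i)
        + (1 - p) * avg (z k) i := by
  have hL : ∀ (k : ℕ) (i : V), (laplacian G α *ᵥ (z k ∘ Sum.inl)) i
      = -∑ j ∈ neighbors G i, α i j * (clock (z k) j - clock (z k) i) :=
    fun k i => laplacian_mulVec G hG α _ i
  have hx : ∀ (k : ℕ) (i : V), (systemMatrix G α r τ κ₁ κ₂ p *ᵥ z k) (Sum.inl i)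
      = clock (z k) i + τ * r i * skew (z k) i := by
    intro k i
    simp [systemMatrix, Matrix.fromBlocks_mulVec, Matrix.fromCols_mulVec, Matrix.smul_mulVec,
      Matrix.mulVec_diagonal, clock, skew, mul_assoc]
  have hs : ∀ (k : ℕ) (i : V), (systemMatrix G α r τ κ₁ κ₂ p *ᵥ z k) (Sum.inr (Sum.inl i))
      = skew (z k) i
        + κ₁ * ∑ j ∈ neighbors G i, α i j * (clock (z k) j - clock (z k) i)
        - κ₂ * avg (z k) i := by
    intro k i
    simp [systemMatrix, Matrix.fromBlocks_mulVec, Matrix.fromRows_mulVec, Matrix.smul_mulVec,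
      Matrix.neg_mulVec, hL, skew, avg]
    ring
  have hy : ∀ (k : ℕ) (i : V), (systemMatrix G α r τ κ₁ κ₂ p *ᵥ z k) (Sum.inr (Sum.inr i))
      = p * ∑ j ∈ neighbors G i, α i j * (clock (z k) j - clock (z k) i)
        + (1 - p) * avg (z k) i := by
    intro k i
    simp [systemMatrix, Matrix.fromBlocks_mulVec, Matrix.fromRows_mulVec, Matrix.smul_mulVec,
      Matrix.neg_mulVec, hL, avg]
  constructor
  · intro h k i
    rw [← hx, ← hs, ← hy, ← h k]
    exact ⟨rfl, rfl, rfl⟩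
  · intro h k
    funext a
    rcases a with i | i | i
    · rw [hx]; exact (h k i).1
    · rw [hs]; exact (h k i).2.1
    · rw [hy]; exact (h k i).2.2

end ClockSync

/-!
The "only if" direction tests synchronization on special initial states. Two nodes that reach no
common node span two disjoint sets of nodes without outgoing edges, on which the system evolves
independently (`Synchronizes.connected`). If `κ₁ = κ₂`, every state `(x, 0, -L x)` is at rest
(`Synchronizes.ne`). If `κ₂ = 0`, the clocks and skew corrections form an undamped double integrator,
which is unstable because `R L` has a nonzero eigenvalue (`Synchronizes.damping_ne_zero`). Averages
with respect to the left null vector `ξ` of `L` obey a closed three-dimensional recursion, in which the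
average of `y` decays with ratio `1 - p`; since `κ₂ ≠ 0`, this forces `|1 - p| < 1`
(`Synchronizes.abs_one_sub_lt_one`). Finally, the second differences of a synchronizing clock tend to
zero, which rules out eigenvectors with `μ ≠ 1`, `|μ| ≥ 1` and nonzero clocks; the clocks of an
eigenvector vanish only if the eigenvector does (`Synchronizes.norm_eigenvalue_lt_one`).

Conversely, an initial state is split along the generalized eigenspaces of the complexified matrix.
The components for `|μ| < 1` die out (`tendsto_pow_apply_of_norm_lt_one`), and the generalized
eigenspace for `μ = 1` consists of the states in which all clocks agree and run at one speed
(`eq_of_mem_maxGenEigenspace_one`).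

The limit line is read off from the `ξ`-average of `R⁻¹ x`, which is known in closed form
(`IsTrajectory.average_clock`, `SynchronizesTo.eq`). A left null vector exists because `L 1 = 0`; it
may be taken nonnegative because `|w|` is a left null vector whenever `w` is; and it is unique up to a
factor because a nonzero nonnegative left null vector is positive at the root
(`exists_unique_left_null_vector`).
-/

namespace ClockSync

section Laplacian

variable {V : Type*} [Fintype V]

/-! ### Reachability and the kernels of the Laplacian -/

lemma mem_neighbors {G : Digraph V} {i j : V} : j ∈ neighbors G i ↔ G.Adj i j := by
  simp [neighbors]

/-- A finite digraph in which every two nodes reach a common node has a root. -/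
lemma connected_of_common_reachable [Nonempty V] {G : Digraph V}
    (h : ∀ i j, ∃ k, Relation.ReflTransGen G.Adj i k ∧ Relation.ReflTransGen G.Adj j k) :
    Connected G :=
  Directed.finite_le (r := Relation.ReflTransGen G.Adj) (f := id) h id

variable [DecidableEq V] {G : Digraph V} {α : V → V → ℝ}

lemma laplacian_apply_adj (hG : ∀ i, ¬ G.Adj i i) {i j : V} (h : G.Adj i j) :
    laplacian G α i j = -α i j := by
  have : i ≠ j := fun e => hG i (e ▸ h)
  simp [laplacian, this, h]

lemma laplacian_apply_nonpos (hα : ∀ i j, G.Adj i j → 0 < α i j) {i j : V} (h : i ≠ j) :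
    laplacian G α i j ≤ 0 := by
  by_cases ha : G.Adj i j
  · simp [laplacian, h, ha, (hα i j ha).le]
  · simp [laplacian, h, ha]

lemma laplacian_diag (i : V) : laplacian G α i i = ∑ j ∈ neighbors G i, α i j := by
  simp [laplacian]

lemma laplacian_mulVec_const (hG : ∀ i, ¬ G.Adj i i) {x : V → ℝ} (hx : ∀ i j, x i = x j) :
    laplacian G α *ᵥ x = 0 := by
  funext i
  rw [laplacian_mulVec G hG, Finset.sum_eq_zero, neg_zero, Pi.zero_apply]
  intro j _
  rw [hx j i, sub_self, mul_zero]

/-- The maximum principle for the Laplacian: the maximum of a harmonic function is taken on at every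
node that can be reached from a maximizer. -/
lemma eq_of_reachable_of_laplacian_mulVec_eq_zero (hG : ∀ i, ¬ G.Adj i i)
    (hα : ∀ i j, G.Adj i j → 0 < α i j) {x : V → ℝ} (hx : laplacian G α *ᵥ x = 0) {i j : V}
    (hi : ∀ k, x k ≤ x i) (hij : Relation.ReflTransGen G.Adj i j) : x j = x i := by
  induction hij with
  | refl => rfl
  | @tail b c _ hbc ih =>
    have h0 := congrFun hx b
    rw [laplacian_mulVec G hG, Pi.zero_apply, neg_eq_zero, Finset.sum_eq_zero_iff_of_nonpos] at h0
    · have := h0 c (mem_neighbors.2 hbc)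
      rcases mul_eq_zero.1 this with h | h
      · exact absurd h (hα b c hbc).ne'
      · linarith
    · intro k hk
      exact mul_nonpos_of_nonneg_of_nonpos (hα b k (mem_neighbors.1 hk)).le
        (by linarith [hi k])

/-- The kernel of the Laplacian of a connected graph consists of the constant vectors. -/
lemma eq_of_laplacian_mulVec_eq_zero (hG : ∀ i, ¬ G.Adj i i)
    (hα : ∀ i j, G.Adj i j → 0 < α i j) (hc : Connected G) {x : V → ℝ}
    (hx : laplacian G α *ᵥ x = 0) (i j : V) : x i = x j := by
  obtain ⟨root, hroot⟩ := hc
  have : Nonempty V := ⟨root⟩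
  obtain ⟨a, ha⟩ := Finite.exists_max x
  obtain ⟨b, hb⟩ := Finite.exists_min x
  have h1 := eq_of_reachable_of_laplacian_mulVec_eq_zero hG hα hx ha (hroot a)
  have h2 := eq_of_reachable_of_laplacian_mulVec_eq_zero hG hα (x := -x) (i := b) (j := root)
    (by rw [mulVec_neg, hx, neg_zero]) (fun k => by simpa using hb k) (hroot b)
  simp only [Pi.neg_apply, neg_inj] at h2
  linarith [ha i, ha j, hb i, hb j]

/-- The entrywise absolute value of a left null vector of the Laplacian is a left null vector:
the triangle inequality makes every entry of `|w| L` nonpositive, and the entries add up to zero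
because the rows of `L` do. -/
lemma abs_vecMul_laplacian (hG : ∀ i, ¬ G.Adj i i) (hα : ∀ i j, G.Adj i j → 0 < α i j)
    {w : V → ℝ} (hw : w ᵥ* laplacian G α = 0) : (fun i => |w i|) ᵥ* laplacian G α = 0 := by
  set L := laplacian G α with hL
  have hle : ∀ j ∈ Finset.univ, ((fun i => |w i|) ᵥ* L) j ≤ 0 := by
    intro j _
    have h0 : ∑ i, w i * L i j = 0 := congrFun hw j
    have hd : 0 ≤ L j j := by
      rw [hL, laplacian_diag]
      exact Finset.sum_nonneg fun k hk => (hα j k (mem_neighbors.1 hk)).le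
    change ∑ i, |w i| * L i j ≤ 0
    rw [← Finset.add_sum_erase _ _ (Finset.mem_univ j)] at h0 ⊢
    have h1 : |w j| * L j j ≤ ∑ i ∈ Finset.univ.erase j, |w i * L i j| := by
      calc |w j| * L j j = |∑ i ∈ Finset.univ.erase j, w i * L i j| := by
            rw [eq_neg_of_add_eq_zero_right h0, abs_neg, abs_mul, abs_of_nonneg hd]
        _ ≤ _ := Finset.abs_sum_le_sum_abs _ _
    have h2 : ∑ i ∈ Finset.univ.erase j, |w i * L i j|
        = -∑ i ∈ Finset.univ.erase j, |w i| * L i j := by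
      rw [← Finset.sum_neg_distrib]
      refine Finset.sum_congr rfl fun i hi => ?_
      rw [abs_mul, abs_of_nonpos (laplacian_apply_nonpos hα (Finset.ne_of_mem_erase hi)), mul_neg]
    linarith
  have hsum : ∑ j, ((fun i => |w i|) ᵥ* L) j = 0 := by
    have h1 : L *ᵥ 1 = 0 := laplacian_mulVec_const hG fun _ _ => rfl
    have := dotProduct_mulVec (fun i => |w i|) L 1
    rw [h1, dotProduct_zero, dotProduct_one] at this
    exact this.symm
  funext j
  exact (Finset.sum_eq_zero_iff_of_nonpos hle).1 hsum j (Finset.mem_univ j)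

/-- The support of a nonnegative left null vector of the Laplacian is closed under edges. -/
lemma pos_of_reachable_of_vecMul_laplacian_eq_zero (hG : ∀ i, ¬ G.Adj i i)
    (hα : ∀ i j, G.Adj i j → 0 < α i j) {w : V → ℝ} (hw : w ᵥ* laplacian G α = 0)
    (h0 : ∀ i, 0 ≤ w i) {i j : V} (hi : 0 < w i) (hij : Relation.ReflTransGen G.Adj i j) :
    0 < w j := by
  induction hij with
  | refl => exact hi
  | @tail b c _ hbc ih =>
    refine (h0 c).lt_of_ne' fun hc => ?_
    have hsum : ∑ k, w k * laplacian G α k c = 0 := congrFun hw c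
    rw [Finset.sum_eq_zero_iff_of_nonpos] at hsum
    · have := hsum b (Finset.mem_univ b)
      rw [laplacian_apply_adj hG hbc] at this
      nlinarith [mul_pos ih (hα b c hbc)]
    · intro k _
      by_cases hk : k = c
      · simp [hk, hc]
      · exact mul_nonpos_of_nonneg_of_nonpos (h0 k) (laplacian_apply_nonpos hα hk)

/-- On a connected graph, a left null vector of the Laplacian with zero sum vanishes: its positive
and its negative part are nonnegative null vectors, so if both were nonzero, then both would be
positive at the root. -/
lemma eq_zero_of_vecMul_laplacian_eq_zero (hG : ∀ i, ¬ G.Adj i i)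
    (hα : ∀ i j, G.Adj i j → 0 < α i j) (hc : Connected G) {w : V → ℝ}
    (hw : w ᵥ* laplacian G α = 0) (hs : ∑ i, w i = 0) : w = 0 := by
  obtain ⟨root, hroot⟩ := hc
  have key : ∀ u : V → ℝ, u ᵥ* laplacian G α = 0 → ∀ i, 0 < u i → 0 < u root := by
    intro u hu i hi
    have hv : ((fun i => |u i|) + u) ᵥ* laplacian G α = 0 := by
      rw [add_vecMul, abs_vecMul_laplacian hG hα hu, hu, add_zero]
    have := pos_of_reachable_of_vecMul_laplacian_eq_zero hG hα hv
      (fun k => by have := neg_abs_le (u k); simp only [Pi.add_apply]; linarith)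
      (i := i) (by simp only [Pi.add_apply]; positivity) (hroot i)
    by_contra hneg
    rw [not_lt] at hneg
    simp [abs_of_nonpos hneg] at this
  by_contra hne
  obtain ⟨i, hi⟩ := Function.ne_iff.1 hne
  obtain ⟨a, -, ha⟩ := Finset.exists_pos_of_sum_zero_of_exists_nonzero w hs
    ⟨i, Finset.mem_univ i, hi⟩
  obtain ⟨b, -, hb⟩ := Finset.exists_pos_of_sum_zero_of_exists_nonzero (s := Finset.univ) (-w)
    (by simp [hs]) ⟨i, Finset.mem_univ i, by simpa using hi⟩
  have h1 := key w hw a ha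
  have h2 := key (-w) (by rw [neg_vecMul, hw, neg_zero]) b hb
  simp only [Pi.neg_apply] at h2
  linarith

/-- The Laplacian of a connected graph has a unique left null vector of total mass one, and this
vector is nonnegative. -/
lemma exists_unique_left_null_vector (hG : ∀ i, ¬ G.Adj i i)
    (hα : ∀ i j, G.Adj i j → 0 < α i j) (hc : Connected G) :
    ∃ ξ : V → ℝ, (∀ w : V → ℝ, (w ᵥ* laplacian G α = 0 ∧ ∑ i, w i = 1) ↔ w = ξ) ∧
      ∀ i, 0 ≤ ξ i := by
  have : Nonempty V := ⟨hc.choose⟩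
  have hdet : (laplacian G α).det = 0 :=
    exists_mulVec_eq_zero_iff.1 ⟨1, one_ne_zero, laplacian_mulVec_const hG fun _ _ => rfl⟩
  obtain ⟨w, hw0, hw⟩ := exists_vecMul_eq_zero_iff.2 hdet
  obtain ⟨i, hi⟩ := Function.ne_iff.1 hw0
  have hpos : 0 < ∑ i, |w i| := Finset.sum_pos' (fun j _ => abs_nonneg _)
    ⟨i, Finset.mem_univ i, abs_pos.2 hi⟩
  set ξ : V → ℝ := (∑ i, |w i|)⁻¹ • fun i => |w i| with hξ
  have h1 : ξ ᵥ* laplacian G α = 0 := by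
    rw [hξ, smul_vecMul, abs_vecMul_laplacian hG hα hw, smul_zero]
  have h2 : ∑ i, ξ i = 1 := by
    simp only [hξ, Pi.smul_apply, smul_eq_mul, ← Finset.mul_sum]
    exact inv_mul_cancel₀ hpos.ne'
  refine ⟨ξ, fun u => ⟨fun ⟨hu, hus⟩ => ?_, fun h => h ▸ ⟨h1, h2⟩⟩, fun j => ?_⟩
  · refine sub_eq_zero.1 (eq_zero_of_vecMul_laplacian_eq_zero hG hα hc (w := u - ξ) ?_ ?_)
    · rw [sub_vecMul, hu, h1, sub_zero]
    · simp [hus, h2]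
  · simp only [hξ, Pi.smul_apply, smul_eq_mul]
    positivity

end Laplacian

section Sequences

/-! ### Scalar sequences and powers of an endomorphism -/

lemma tendsto_second_difference {𝕜 : Type*} [Ring 𝕜] [TopologicalSpace 𝕜] [IsTopologicalRing 𝕜]
    {u : ℕ → 𝕜} {a b : 𝕜} (h : Tendsto (fun k : ℕ => u k - a * k) atTop (𝓝 b)) :
    Tendsto (fun k => u (k + 2) - 2 * u (k + 1) + u k) atTop (𝓝 0) := by
  have h1 := h.comp (tendsto_add_atTop_nat 1)
  have h2 := h.comp (tendsto_add_atTop_nat 2)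
  convert (h2.sub (h1.const_mul 2)).add h using 2 with k
  · simp only [Function.comp_apply]
    push_cast
    noncomm_ring
  · noncomm_ring

/-- A geometric sequence with ratio `μ ≠ 1` outside the open unit disk approaches a line only if it
vanishes, because its second differences form a geometric sequence with the same ratio. -/
lemma eq_zero_of_tendsto_geometric_sub {μ c a b : ℂ} (h1 : μ ≠ 1) (hμ : 1 ≤ ‖μ‖)
    (h : Tendsto (fun k : ℕ => μ ^ k * c - a * k) atTop (𝓝 b)) : c = 0 := by
  have h2 : Tendsto (fun k : ℕ => ‖μ ^ (k + 2) * c - 2 * (μ ^ (k + 1) * c) + μ ^ k * c‖) atTop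
      (𝓝 0) := by
    simpa only [norm_zero] using (tendsto_second_difference h).norm
  have h3 : ‖(μ - 1) ^ 2 * c‖ ≤ 0 := by
    refine ge_of_tendsto' h2 fun k => ?_
    have : μ ^ (k + 2) * c - 2 * (μ ^ (k + 1) * c) + μ ^ k * c
        = μ ^ k * ((μ - 1) ^ 2 * c) := by ring
    rw [this, norm_mul (μ ^ k), norm_pow]
    exact le_mul_of_one_le_left (norm_nonneg ((μ - 1) ^ 2 * c)) (one_le_pow₀ hμ)
  have h4 := norm_le_zero_iff.1 h3
  exact (mul_eq_zero.1 h4).resolve_left (pow_ne_zero 2 (sub_ne_zero.2 h1))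

/-- The orbit of a generalized eigenvector is bounded by a geometric sequence with any ratio `ρ`
above the modulus of the eigenvalue. -/
lemma exists_norm_pow_apply_le {E : Type*} [NormedAddCommGroup E] [NormedSpace ℂ E]
    (f : Module.End ℂ E) {μ : ℂ} {ρ : ℝ} (hρ : ‖μ‖ < ρ) (m : ℕ) {v : E}
    (hv : ((f - μ • (1 : Module.End ℂ E)) ^ m) v = 0) :
    ∃ C : ℝ, ∀ k : ℕ, ‖(f ^ k) v‖ ≤ C * ρ ^ k := by
  induction m generalizing v with
  | zero => exact ⟨0, fun k => by simp_all⟩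
  | succ m ih =>
    rw [pow_succ, Module.End.mul_apply] at hv
    obtain ⟨C, hC⟩ := ih hv
    have hρ0 : 0 < ρ := (norm_nonneg μ).trans_lt hρ
    have hgap : 0 < ρ - ‖μ‖ := sub_pos.2 hρ
    -- the bound `D` survives the step `‖f ^ (k + 1) v‖ ≤ ‖μ‖ D ρ ^ k + C ρ ^ k ≤ D ρ ^ (k + 1)`
    set D := max ‖v‖ (C / (ρ - ‖μ‖)) with hD
    have hCD : C ≤ D * (ρ - ‖μ‖) := (div_le_iff₀ hgap).1 (le_max_right _ _)
    refine ⟨D, fun k => ?_⟩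
    induction k with
    | zero => simp [hD]
    | succ k ihk =>
      have hstep : (f ^ (k + 1)) v
          = μ • (f ^ k) v + (f ^ k) ((f - μ • (1 : Module.End ℂ E)) v) := by
        rw [pow_succ, Module.End.mul_apply]
        simp [map_sub]
      calc ‖(f ^ (k + 1)) v‖ ≤ ‖μ‖ * (D * ρ ^ k) + C * ρ ^ k := by
            rw [hstep]
            refine (norm_add_le _ _).trans (add_le_add ?_ (hC k))
            rw [norm_smul]
            exact mul_le_mul_of_nonneg_left ihk (norm_nonneg _)
        _ ≤ ‖μ‖ * (D * ρ ^ k) + D * (ρ - ‖μ‖) * ρ ^ k := by gcongr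
        _ = D * ρ ^ (k + 1) := by ring

lemma tendsto_pow_apply_of_norm_lt_one {E : Type*} [NormedAddCommGroup E] [NormedSpace ℂ E]
    (f : Module.End ℂ E) {μ : ℂ} (hμ : ‖μ‖ < 1) {v : E} (hv : v ∈ f.maxGenEigenspace μ) :
    Tendsto (fun k : ℕ => (f ^ k) v) atTop (𝓝 0) := by
  obtain ⟨m, hm⟩ := (Module.End.mem_maxGenEigenspace f μ v).1 hv
  obtain ⟨ρ, h1, h2⟩ := exists_between hμ
  obtain ⟨C, hC⟩ := exists_norm_pow_apply_le f h1 m hm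
  have h3 := (tendsto_pow_atTop_nhds_zero_of_lt_one ((norm_nonneg μ).trans h1.le) h2).const_mul C
  rw [mul_zero] at h3
  exact squeeze_zero_norm hC h3

/-- A complex matrix with nonzero trace has a nonzero eigenvalue. -/
lemma exists_eigenvector_of_trace_ne_zero {n : Type*} [Fintype n] [DecidableEq n]
    {M : Matrix n n ℂ} (hM : M.trace ≠ 0) : ∃ l : ℂ, l ≠ 0 ∧ ∃ v ≠ 0, M *ᵥ v = l • v := by
  rw [trace_eq_sum_roots_charpoly] at hM
  obtain ⟨l, hl, hl0⟩ : ∃ l ∈ M.charpoly.roots, l ≠ 0 := by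
    by_contra! h
    exact hM (Multiset.sum_eq_zero h)
  have hdet := (Polynomial.mem_roots'.1 hl).2
  rw [Polynomial.IsRoot, eval_charpoly] at hdet
  obtain ⟨v, hv0, hv⟩ := exists_mulVec_eq_zero_iff.2 hdet
  rw [sub_mulVec, sub_eq_zero] at hv
  refine ⟨l, hl0, v, hv0, hv.symm.trans ?_⟩
  simp [scalar_apply, ← smul_one_eq_diagonal, smul_mulVec]

end Sequences

section System

/-! ### Real trajectories -/

lemma SynchronizesTo.tendsto_clock_sub {V : Type*} {t₀ τ : ℝ} {z : ℕ → V ⊕ (V ⊕ V) → ℝ} {rs xs : ℝ}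
    (h : SynchronizesTo t₀ τ z rs xs) (i j : V) :
    Tendsto (fun k => clock (z k) i - clock (z k) j) atTop (𝓝 0) := by
  simpa using (h i).sub (h j)

lemma SynchronizesTo.tendsto_average {V : Type*} [Fintype V] {t₀ τ : ℝ}
    {z : ℕ → V ⊕ (V ⊕ V) → ℝ} {rs xs : ℝ}
    (h : SynchronizesTo t₀ τ z rs xs) (w : V → ℝ) :
    Tendsto (fun k : ℕ => ∑ i, w i * clock (z k) i - (∑ i, w i) * rs * τ * k) atTop
      (𝓝 ((∑ i, w i) * xs)) := by
  have := tendsto_finsetSum Finset.univ fun i _ => (h i).const_mul (w i)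
  rw [← Finset.sum_mul] at this
  refine this.congr fun k => ?_
  simp only [time, Finset.sum_mul, ← Finset.sum_sub_distrib]
  exact Finset.sum_congr rfl fun i _ => by ring

variable {V : Type*} [Fintype V] [DecidableEq V] {G : Digraph V} {α : V → V → ℝ} {r : V → ℝ}
  {t₀ τ κ₁ κ₂ p : ℝ}

lemma isTrajectory_pow (z₀ : V ⊕ (V ⊕ V) → ℝ) :
    IsTrajectory G α r τ κ₁ κ₂ p fun k => systemMatrix G α r τ κ₁ κ₂ p ^ k *ᵥ z₀ := fun k => by
  simp only [pow_succ', mulVec_mulVec]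

/-- The state with the given clocks, skew corrections and moving averages. -/
def state {R : Type*} (x s y : V → R) : V ⊕ (V ⊕ V) → R := Sum.elim x (Sum.elim s y)

/-- The node-wise update rule in terms of the Laplacian. -/
lemma IsTrajectory.step (hG : ∀ i, ¬ G.Adj i i) {z : ℕ → V ⊕ (V ⊕ V) → ℝ}
    (hz : IsTrajectory G α r τ κ₁ κ₂ p z) (k : ℕ) (i : V) :
    clock (z (k + 1)) i = clock (z k) i + τ * r i * skew (z k) i ∧
    skew (z (k + 1)) i = skew (z k) i - κ₁ * (laplacian G α *ᵥ clock (z k)) i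
      - κ₂ * avg (z k) i ∧
    avg (z (k + 1)) i = (1 - p) * avg (z k) i - p * (laplacian G α *ᵥ clock (z k)) i := by
  obtain ⟨h1, h2, h3⟩ := (isTrajectory_iff G hG α r τ κ₁ κ₂ p z).1 hz k i
  rw [laplacian_mulVec G hG]
  exact ⟨h1, by rw [h2]; ring, by rw [h3]; ring⟩

/-- A set of nodes without outgoing edges is not influenced from outside: clocks that agree there,
with zero skew correction and zero moving average, never move. -/
lemma IsTrajectory.eq_of_closed (hG : ∀ i, ¬ G.Adj i i) {z : ℕ → V ⊕ (V ⊕ V) → ℝ}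
    (hz : IsTrajectory G α r τ κ₁ κ₂ p z) {S : Set V} (hS : ∀ i ∈ S, ∀ j, G.Adj i j → j ∈ S)
    {c : ℝ} (h0 : ∀ i ∈ S, clock (z 0) i = c ∧ skew (z 0) i = 0 ∧ avg (z 0) i = 0) (k : ℕ) :
    ∀ i ∈ S, clock (z k) i = c ∧ skew (z k) i = 0 ∧ avg (z k) i = 0 := by
  induction k with
  | zero => exact h0
  | succ k ih =>
    intro i hi
    obtain ⟨h1, h2, h3⟩ := hz.step hG k i
    have hL : (laplacian G α *ᵥ clock (z k)) i = 0 := by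
      rw [laplacian_mulVec G hG, Finset.sum_eq_zero, neg_zero]
      intro j hj
      rw [(ih j (hS i hi j (mem_neighbors.1 hj))).1, (ih i hi).1, sub_self, mul_zero]
    obtain ⟨g1, g2, g3⟩ := ih i hi
    rw [h1, h2, h3, hL, g1, g2, g3]
    simp

/-- If two nodes reach no common node, then the two sets that they reach evolve independently. -/
lemma Synchronizes.connected [Nonempty V] (hG : ∀ i, ¬ G.Adj i i)
    (h : Synchronizes G α r t₀ τ κ₁ κ₂ p) : Connected G := by
  refine connected_of_common_reachable fun i j => ?_
  by_contra! hij
  classical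
  let S : V → Set V := fun i => {k | Relation.ReflTransGen G.Adj i k}
  have hS : ∀ a, ∀ b ∈ S a, ∀ c, G.Adj b c → c ∈ S a := fun a b hb c hbc => hb.tail hbc
  have hz := isTrajectory_pow (G := G) (α := α) (r := r) (τ := τ) (κ₁ := κ₁) (κ₂ := κ₂) (p := p)
    (state (fun k => if k ∈ S i then 1 else 0) 0 0)
  obtain ⟨rs, xs, hs⟩ := h _ hz
  have hi := hz.eq_of_closed hG (hS i) (c := 1) fun k hk => by
    simp [clock, skew, avg, state, hk]
  have hj := hz.eq_of_closed hG (hS j) (c := 0) fun k hk => by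
    have : k ∉ S i := fun hk' => hij k hk' hk
    simp [clock, skew, avg, state, this]
  have hlim := hs.tendsto_clock_sub i j
  simp only [(hi _ i .refl).1, (hj _ j .refl).1, sub_zero] at hlim
  exact one_ne_zero (tendsto_nhds_unique tendsto_const_nhds hlim)

/-- If `κ₁ = κ₂`, then the states `(x, 0, -L x)` are at rest. -/
lemma Synchronizes.ne [Nontrivial V] (hG : ∀ i, ¬ G.Adj i i)
    (h : Synchronizes G α r t₀ τ κ₁ κ₂ p) : κ₁ ≠ κ₂ := by
  rintro rfl
  obtain ⟨a, b, hab⟩ := exists_pair_ne V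
  set z : ℕ → V ⊕ (V ⊕ V) → ℝ := fun _ =>
    state (Pi.single a 1) 0 (-(laplacian G α *ᵥ Pi.single a 1)) with hzdef
  have hz : IsTrajectory G α r τ κ₁ κ₁ p z := by
    rw [isTrajectory_iff G hG]
    intro k i
    have h1 : ∑ j ∈ neighbors G i, α i j * (clock (z k) j - clock (z k) i) = avg (z k) i := by
      have := laplacian_mulVec G hG α (clock (z k)) i
      exact (neg_eq_iff_eq_neg.2 this).symm
    have h2 : skew (z k) i = 0 := rfl
    refine ⟨?_, ?_, ?_⟩
    · change clock (z k) i = _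
      rw [h2, mul_zero, add_zero]
    · change skew (z k) i = _
      rw [h1, add_sub_cancel_right]
    · change avg (z k) i = _
      rw [h1]
      ring
  obtain ⟨rs, xs, hs⟩ := h _ hz
  have hlim := hs.tendsto_clock_sub a b
  simp only [hzdef, clock, state, Sum.elim_inl, Pi.single_eq_same, Pi.single_eq_of_ne hab.symm,
    sub_zero] at hlim
  exact one_ne_zero (tendsto_nhds_unique tendsto_const_nhds hlim)

/-! ### Averages with respect to a left null vector -/

/-- The averages of `y`, `s` and `R⁻¹ x` with respect to a left null vector of the Laplacian follow a
closed three-dimensional recursion. -/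
lemma IsTrajectory.average_step (hG : ∀ i, ¬ G.Adj i i) (hr : ∀ i, r i ≠ 0)
    {z : ℕ → V ⊕ (V ⊕ V) → ℝ} (hz : IsTrajectory G α r τ κ₁ κ₂ p z) {ξ : V → ℝ}
    (hξ : ξ ᵥ* laplacian G α = 0) (k : ℕ) :
    ∑ i, ξ i * avg (z (k + 1)) i = (1 - p) * ∑ i, ξ i * avg (z k) i ∧
    ∑ i, ξ i * skew (z (k + 1)) i = ∑ i, ξ i * skew (z k) i - κ₂ * ∑ i, ξ i * avg (z k) i ∧
    ∑ i, ξ i / r i * clock (z (k + 1)) i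
      = ∑ i, ξ i / r i * clock (z k) i + τ * ∑ i, ξ i * skew (z k) i := by
  have hL : ∑ i, ξ i * (laplacian G α *ᵥ clock (z k)) i = 0 := by
    have := dotProduct_mulVec ξ (laplacian G α) (clock (z k))
    rwa [hξ, zero_dotProduct] at this
  refine ⟨?_, ?_, ?_⟩
  · have : ∀ i, ξ i * avg (z (k + 1)) i = (1 - p) * (ξ i * avg (z k) i)
        - p * (ξ i * (laplacian G α *ᵥ clock (z k)) i) := fun i => by
      rw [(hz.step hG k i).2.2]; ring
    simp only [this, Finset.sum_sub_distrib, ← Finset.mul_sum, hL]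
    ring
  · have : ∀ i, ξ i * skew (z (k + 1)) i = ξ i * skew (z k) i
        - κ₁ * (ξ i * (laplacian G α *ᵥ clock (z k)) i) - κ₂ * (ξ i * avg (z k) i) := fun i => by
      rw [(hz.step hG k i).2.1]; ring
    simp only [this, Finset.sum_sub_distrib, ← Finset.mul_sum, hL]
    ring
  · have : ∀ i, ξ i / r i * clock (z (k + 1)) i = ξ i / r i * clock (z k) i
        + τ * (ξ i * skew (z k) i) := fun i => by
      rw [(hz.step hG k i).1]; field_simp [hr i]
    simp only [this, Finset.sum_add_distrib, ← Finset.mul_sum]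

/-- The averaged `y` decays with ratio `1 - p`, and `κ₂` times this average drives the second
differences of the averaged clock. -/
lemma Synchronizes.abs_one_sub_lt_one (hG : ∀ i, ¬ G.Adj i i) (hr : ∀ i, r i ≠ 0) (hτ : τ ≠ 0)
    (hκ : κ₂ ≠ 0) {ξ : V → ℝ} (hξ : ξ ᵥ* laplacian G α = 0) (hξ1 : ∑ i, ξ i = 1)
    (h : Synchronizes G α r t₀ τ κ₁ κ₂ p) : |1 - p| < 1 := by
  have hz := isTrajectory_pow (G := G) (α := α) (r := r) (τ := τ) (κ₁ := κ₁) (κ₂ := κ₂) (p := p)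
    (state 0 0 1)
  set z := fun k => systemMatrix G α r τ κ₁ κ₂ p ^ k *ᵥ state (0 : V → ℝ) 0 1 with hzdef
  obtain ⟨rs, xs, hs⟩ := h _ hz
  have hy : ∀ k, ∑ i, ξ i * avg (z k) i = (1 - p) ^ k := by
    intro k
    induction k with
    | zero => simp [hzdef, avg, state, hξ1]
    | succ k ih => rw [(hz.average_step hG hr hξ k).1, ih, pow_succ']
  have h2 := tendsto_second_difference (hs.tendsto_average fun i => ξ i / r i)
  have h3 : ∀ k, ∑ i, ξ i / r i * clock (z (k + 2)) i
      - 2 * ∑ i, ξ i / r i * clock (z (k + 1)) i + ∑ i, ξ i / r i * clock (z k) i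
      = -(τ * κ₂) * (1 - p) ^ k := by
    intro k
    rw [(hz.average_step hG hr hξ (k + 1)).2.2, (hz.average_step hG hr hξ k).2.1,
      (hz.average_step hG hr hξ k).2.2, hy]
    ring
  simp only [h3] at h2
  have h4 := h2.const_mul (-(τ * κ₂))⁻¹
  have hne : -(τ * κ₂) ≠ 0 := neg_ne_zero.2 (mul_ne_zero hτ hκ)
  simp only [inv_mul_cancel_left₀ hne, mul_zero] at h4
  exact tendsto_pow_atTop_nhds_zero_iff.1 h4

/-- The averaged clock in closed form. -/
lemma IsTrajectory.average_clock (hG : ∀ i, ¬ G.Adj i i) (hr : ∀ i, r i ≠ 0) (hp : p ≠ 0)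
    {z : ℕ → V ⊕ (V ⊕ V) → ℝ} (hz : IsTrajectory G α r τ κ₁ κ₂ p z) {ξ : V → ℝ}
    (hξ : ξ ᵥ* laplacian G α = 0) (k : ℕ) :
    ∑ i, ξ i / r i * clock (z k) i = ∑ i, ξ i / r i * clock (z 0) i
      + τ * k * (∑ i, ξ i * skew (z 0) i - κ₂ / p * ∑ i, ξ i * avg (z 0) i)
      + τ * (κ₂ / p ^ 2) * (∑ i, ξ i * avg (z 0) i) * (1 - (1 - p) ^ k) := by
  have hy : ∀ k, ∑ i, ξ i * avg (z k) i = (1 - p) ^ k * ∑ i, ξ i * avg (z 0) i := by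
    intro k
    induction k with
    | zero => simp
    | succ k ih => rw [(hz.average_step hG hr hξ k).1, ih]; ring
  have hs : ∀ k, ∑ i, ξ i * skew (z k) i = ∑ i, ξ i * skew (z 0) i
      - κ₂ / p * (∑ i, ξ i * avg (z 0) i) * (1 - (1 - p) ^ k) := by
    intro k
    induction k with
    | zero => simp
    | succ k ih => rw [(hz.average_step hG hr hξ k).2.1, ih, hy k]; field_simp; ring
  induction k with
  | zero => simp
  | succ k ih =>
    rw [(hz.average_step hG hr hξ k).2.2, ih, hs k]
    push_cast
    field_simp
    ring

/-- A line that every clock approaches is determined by the closed form of the averaged clock. -/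
lemma SynchronizesTo.eq (hG : ∀ i, ¬ G.Adj i i) (hr : ∀ i, r i ≠ 0) (hτ : τ ≠ 0) (hp : p ≠ 0)
    (hp1 : |1 - p| < 1) {z : ℕ → V ⊕ (V ⊕ V) → ℝ} (hz : IsTrajectory G α r τ κ₁ κ₂ p z)
    {ξ : V → ℝ} (hξ : ξ ᵥ* laplacian G α = 0) (hγ : ∑ i, ξ i / r i ≠ 0) {rs xs : ℝ}
    (h : SynchronizesTo t₀ τ z rs xs) :
    xs = harmonicMean ξ r * ∑ i, ξ i * (1 / r i * clock (z 0) i + τ * (κ₂ / p ^ 2) * avg (z 0) i) ∧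
    rs = harmonicMean ξ r * ∑ i, ξ i * (skew (z 0) i - κ₂ / p * avg (z 0) i) := by
  have h1 := h.tendsto_average fun i => ξ i / r i
  have h2 := (tendsto_pow_atTop_nhds_zero_iff.2 hp1).const_sub 1 |>.const_mul
    (τ * (κ₂ / p ^ 2) * ∑ i, ξ i * avg (z 0) i)
  have h3 := h1.sub h2
  have e1 : ∑ i, ξ i * (1 / r i * clock (z 0) i + τ * (κ₂ / p ^ 2) * avg (z 0) i)
      = ∑ i, ξ i / r i * clock (z 0) i + τ * (κ₂ / p ^ 2) * ∑ i, ξ i * avg (z 0) i := by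
    rw [Finset.mul_sum, ← Finset.sum_add_distrib]
    exact Finset.sum_congr rfl fun i _ => by ring
  have e2 : ∑ i, ξ i * (skew (z 0) i - κ₂ / p * avg (z 0) i)
      = ∑ i, ξ i * skew (z 0) i - κ₂ / p * ∑ i, ξ i * avg (z 0) i := by
    rw [Finset.mul_sum, ← Finset.sum_sub_distrib]
    exact Finset.sum_congr rfl fun i _ => by ring
  rw [e1, e2, harmonicMean]
  have hclosed := hz.average_clock hG hr hp hξ
  set σ := ∑ i, ξ i * skew (z 0) i - κ₂ / p * ∑ i, ξ i * avg (z 0) i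
  set η := ∑ i, ξ i * avg (z 0) i
  set χ := ∑ i, ξ i / r i * clock (z 0) i
  set g := ∑ i, ξ i / r i
  have h4 : Tendsto (fun k : ℕ => χ + τ * (σ - g * rs) * k) atTop
      (𝓝 (g * xs - τ * (κ₂ / p ^ 2) * η * (1 - 0))) := by
    -- the transient terms cancel
    refine h3.congr fun k => ?_
    rw [hclosed k]
    ring
  -- consecutive differences of the left-hand side equal `τ * (σ - g * rs)` and tend to zero
  have h5 := (h4.comp (tendsto_add_atTop_nat 1)).sub h4
  have h6 : τ * (σ - g * rs) = 0 := by
    rw [sub_self] at h5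
    refine tendsto_nhds_unique (tendsto_const_nhds.congr fun k => ?_) h5
    simp only [Function.comp_apply]
    push_cast
    ring
  have h7 : σ = g * rs := by
    have := (mul_eq_zero.1 h6).resolve_left hτ
    linarith
  simp only [h6, zero_mul, add_zero] at h4
  have h8 := tendsto_nhds_unique tendsto_const_nhds h4
  constructor
  · rw [h8, one_div, sub_zero, mul_one, sub_add_cancel, inv_mul_cancel_left₀ hγ]
  · rw [h7]
    field_simp

end System

section ComplexSystem

/-! ### The complexified system -/

lemma re_map_ofReal_mulVec {m n : Type*} [Fintype n] (M : Matrix m n ℝ) (v : n → ℂ) (i : m) :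
    ((M.map Complex.ofReal *ᵥ v) i).re = (M *ᵥ fun j => (v j).re) i := by
  simp [mulVec, dotProduct]

lemma im_map_ofReal_mulVec {m n : Type*} [Fintype n] (M : Matrix m n ℝ) (v : n → ℂ) (i : m) :
    ((M.map Complex.ofReal *ᵥ v) i).im = (M *ᵥ fun j => (v j).im) i := by
  simp [mulVec, dotProduct]

lemma map_ofReal_mulVec_ofReal {m n : Type*} [Fintype n] (M : Matrix m n ℝ) (v : n → ℝ) :
    (M.map Complex.ofReal *ᵥ fun j => (v j : ℂ)) = fun i => ((M *ᵥ v) i : ℂ) := by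
  funext i
  simp [mulVec, dotProduct]

lemma exists_eq_state {V R : Type*} (v : V ⊕ (V ⊕ V) → R) : ∃ x s y, v = state x s y :=
  ⟨fun i => v (.inl i), fun i => v (.inr (.inl i)), fun i => v (.inr (.inr i)), by
    funext a; rcases a with i | i | i <;> rfl⟩

lemma state_inj {V R : Type*} {x s y x' s' y' : V → R} :
    state x s y = state x' s' y' ↔ x = x' ∧ s = s' ∧ y = y' := by
  constructor
  · intro h
    exact ⟨funext fun i => congrFun h (.inl i), funext fun i => congrFun h (.inr (.inl i)),
      funext fun i => congrFun h (.inr (.inr i))⟩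
  · rintro ⟨rfl, rfl, rfl⟩
    rfl

lemma sum_div_pos {V : Type*} [Fintype V] {ξ r : V → ℝ} (hξ : ∀ i, 0 ≤ ξ i) (hξ1 : ∑ i, ξ i = 1)
    (hr : ∀ i, 0 < r i) : 0 < ∑ i, ξ i / r i := by
  obtain ⟨i, -, hi⟩ : ∃ i ∈ Finset.univ, ξ i ≠ 0 :=
    Finset.exists_ne_zero_of_sum_ne_zero (by rw [hξ1]; exact one_ne_zero)
  exact Finset.sum_pos' (fun j _ => div_nonneg (hξ j) (hr j).le)
    ⟨i, Finset.mem_univ i, div_pos ((hξ i).lt_of_ne' hi) (hr i)⟩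

variable {V : Type*} [Fintype V] [DecidableEq V] {G : Digraph V} {α : V → V → ℝ} {r : V → ℝ}
  {t₀ τ κ₁ κ₂ p : ℝ}

/-- The system matrix acting on complex states. -/
noncomputable def complexSystem (G : Digraph V) (α : V → V → ℝ) (r : V → ℝ) (τ κ₁ κ₂ p : ℝ) :
    Module.End ℂ (V ⊕ (V ⊕ V) → ℂ) :=
  Matrix.toLin' ((systemMatrix G α r τ κ₁ κ₂ p).map Complex.ofReal)

/-- The Laplacian as a complex matrix. -/
noncomputable def complexLaplacian (G : Digraph V) (α : V → V → ℝ) : Matrix V V ℂ :=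
  (laplacian G α).map Complex.ofReal

lemma eq_of_complexLaplacian_mulVec_eq_zero (hG : ∀ i, ¬ G.Adj i i)
    (hα : ∀ i j, G.Adj i j → 0 < α i j) (hc : Connected G) {x : V → ℂ}
    (hx : complexLaplacian G α *ᵥ x = 0) (i j : V) : x i = x j := by
  apply Complex.ext
  · exact eq_of_laplacian_mulVec_eq_zero hG hα hc (x := fun j => (x j).re)
      (funext fun i => by rw [← re_map_ofReal_mulVec]; exact congrArg Complex.re (congrFun hx i)) i j
  · exact eq_of_laplacian_mulVec_eq_zero hG hα hc (x := fun j => (x j).im)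
      (funext fun i => by rw [← im_map_ofReal_mulVec]; exact congrArg Complex.im (congrFun hx i)) i j

lemma complexLaplacian_mulVec_const (hG : ∀ i, ¬ G.Adj i i) {x : V → ℂ} (hx : ∀ i j, x i = x j) :
    complexLaplacian G α *ᵥ x = 0 := by
  funext i
  apply Complex.ext
  · rw [complexLaplacian, re_map_ofReal_mulVec,
      laplacian_mulVec_const hG fun i j => congrArg Complex.re (hx i j)]
    rfl
  · rw [complexLaplacian, im_map_ofReal_mulVec,
      laplacian_mulVec_const hG fun i j => congrArg Complex.im (hx i j)]
    rfl

lemma sum_mul_complexLaplacian_mulVec {ξ : V → ℝ} (hξ : ξ ᵥ* laplacian G α = 0) (x : V → ℂ) :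
    ∑ i, (ξ i : ℂ) * (complexLaplacian G α *ᵥ x) i = 0 := by
  have h : ∀ y : V → ℝ, ∑ i, ξ i * (laplacian G α *ᵥ y) i = 0 := fun y => by
    have := dotProduct_mulVec ξ (laplacian G α) y
    rwa [hξ, zero_dotProduct] at this
  apply Complex.ext
  · simpa [complexLaplacian, re_map_ofReal_mulVec] using h fun j => (x j).re
  · simpa [complexLaplacian, im_map_ofReal_mulVec] using h fun j => (x j).im

lemma complexSystem_state (x s y : V → ℂ) :
    complexSystem G α r τ κ₁ κ₂ p (state x s y) = state (fun i => x i + τ * r i * s i)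
      (fun i => s i - κ₁ * (complexLaplacian G α *ᵥ x) i - κ₂ * y i)
      (fun i => (1 - p) * y i - p * (complexLaplacian G α *ᵥ x) i) := by
  have e1 : ((systemMatrix G α r τ κ₁ κ₂ p).map Complex.ofReal) = Matrix.fromBlocks
      1 (Matrix.fromCols ((τ : ℂ) • Matrix.diagonal fun i => (r i : ℂ)) 0)
      (Matrix.fromRows (-((κ₁ : ℂ) • complexLaplacian G α)) ((p : ℂ) • (-complexLaplacian G α)))
      (Matrix.fromBlocks 1 (-((κ₂ : ℂ) • (1 : Matrix V V ℂ))) 0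
        ((1 - p : ℂ) • (1 : Matrix V V ℂ))) := by
    ext (i | i | i) (j | j | j) <;>
      simp [systemMatrix, complexLaplacian, Matrix.one_apply, Matrix.diagonal_apply,
        apply_ite Complex.ofReal]
  funext a
  rcases a with i | i | i <;>
    simp [complexSystem, e1, state, Matrix.fromBlocks_mulVec, Matrix.fromCols_mulVec,
      Matrix.fromRows_mulVec, Matrix.smul_mulVec, Matrix.neg_mulVec, Matrix.mulVec_diagonal,
      Function.comp_def, mul_assoc] <;> ring

/-- Synchronization carries over to the orbits of complex states: their real and imaginary parts are
trajectories. -/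
lemma Synchronizes.complex (h : Synchronizes G α r t₀ τ κ₁ κ₂ p) (v : V ⊕ (V ⊕ V) → ℂ) :
    ∃ a b : ℂ, ∀ i : V, Tendsto
      (fun k : ℕ => (complexSystem G α r τ κ₁ κ₂ p ^ k) v (.inl i) - a * k) atTop (𝓝 b) := by
  set f := complexSystem G α r τ κ₁ κ₂ p with hf
  have hstep : ∀ k : ℕ, (f ^ (k + 1)) v
      = (systemMatrix G α r τ κ₁ κ₂ p).map Complex.ofReal *ᵥ (f ^ k) v := fun k => by
    rw [pow_succ', Module.End.mul_apply, hf, complexSystem, Matrix.toLin'_apply]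
  obtain ⟨rs₁, xs₁, h1⟩ := h (fun k a => ((f ^ k) v a).re) fun k => by
    funext a
    simp only [hstep, re_map_ofReal_mulVec]
  obtain ⟨rs₂, xs₂, h2⟩ := h (fun k a => ((f ^ k) v a).im) fun k => by
    funext a
    simp only [hstep, im_map_ofReal_mulVec]
  refine ⟨τ * (rs₁ + rs₂ * Complex.I), xs₁ + xs₂ * Complex.I, fun i => ?_⟩
  have g1 := (Complex.continuous_ofReal.tendsto _).comp (h1 i)
  have g2 := (Complex.continuous_ofReal.tendsto _).comp (h2 i)
  refine (g1.add (g2.mul_const Complex.I)).congr fun k => ?_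
  simp only [Function.comp_apply, clock, time]
  conv_rhs => rw [← Complex.re_add_im ((f ^ k) v (.inl i))]
  push_cast
  ring

/-! ### Spectral conditions that are necessary for synchronization -/

/-- In a synchronizing system, no clocks evolve geometrically with a ratio `μ ≠ 1` outside the open
unit disk. -/
lemma Synchronizes.eq_zero_of_geometric (h : Synchronizes G α r t₀ τ κ₁ κ₂ p) {μ : ℂ} (h1 : μ ≠ 1)
    (hμ : 1 ≤ ‖μ‖) {v : V ⊕ (V ⊕ V) → ℂ} {x : V → ℂ}
    (hv : ∀ (k : ℕ) i, (complexSystem G α r τ κ₁ κ₂ p ^ k) v (.inl i) = μ ^ k * x i) : x = 0 := by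
  obtain ⟨a, b, hab⟩ := h.complex v
  funext i
  have := hab i
  simp only [hv] at this
  exact eq_zero_of_tendsto_geometric_sub h1 hμ this

/-- Without the damping term, the clocks and the skew corrections form a double integrator
`(μ - 1)² x = -κ₁ τ R L x`; of the two values of `μ` that belong to a nonzero eigenvalue of `R L`,
one has real part at least one. -/
lemma Synchronizes.damping_ne_zero [Nontrivial V] (hG : ∀ i, ¬ G.Adj i i)
    (hα : ∀ i j, G.Adj i j → 0 < α i j) (hr : ∀ i, 0 < r i) (hτ : 0 < τ)
    (h : Synchronizes G α r t₀ τ κ₁ κ₂ p) : κ₂ ≠ 0 := by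
  rintro rfl
  have hκ₁ : κ₁ ≠ 0 := h.ne hG
  -- every node but the root has an outgoing edge, so `R L` has positive trace
  have htr : (Matrix.diagonal (fun i => (r i : ℂ)) * complexLaplacian G α).trace ≠ 0 := by
    have hpos : 0 < ∑ i, r i * laplacian G α i i := by
      obtain ⟨root, hroot⟩ := h.connected hG
      obtain ⟨a, ha⟩ := exists_ne root
      have hd : ∀ i, 0 ≤ laplacian G α i i := fun i => by
        rw [laplacian_diag]
        exact Finset.sum_nonneg fun k hk => (hα i k (mem_neighbors.1 hk)).le
      refine Finset.sum_pos' (fun i _ => mul_nonneg (hr i).le (hd i)) ⟨a, Finset.mem_univ a, ?_⟩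
      rcases Relation.ReflTransGen.cases_head (hroot a) with e | ⟨b, hab, -⟩
      · exact absurd e ha
      · rw [laplacian_diag]
        exact mul_pos (hr a) (Finset.sum_pos (fun k hk => hα a k (mem_neighbors.1 hk))
          ⟨b, mem_neighbors.2 hab⟩)
    have heq : (Matrix.diagonal (fun i => (r i : ℂ)) * complexLaplacian G α).trace
        = ((∑ i, r i * laplacian G α i i : ℝ) : ℂ) := by
      simp [Matrix.trace, complexLaplacian, Matrix.diagonal_mul]
    rw [heq]
    exact_mod_cast hpos.ne'
  obtain ⟨l, hl, x, hx0, hx⟩ := exists_eigenvector_of_trace_ne_zero htr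
  have hLx : ∀ i, (r i : ℂ) * (complexLaplacian G α *ᵥ x) i = l * x i := fun i => by
    rw [← mulVec_mulVec] at hx
    simpa [Matrix.mulVec_diagonal] using congrFun hx i
  obtain ⟨w, hw, hw0⟩ : ∃ w : ℂ, w ^ 2 = -(κ₁ * τ * l) ∧ 0 ≤ w.re := by
    obtain ⟨w, hw⟩ := IsAlgClosed.exists_pow_nat_eq (-(κ₁ * τ * l) : ℂ) (n := 2) (by norm_num)
    rcases le_total 0 w.re with h0 | h0
    · exact ⟨w, hw, h0⟩
    · exact ⟨-w, by rw [neg_sq, hw], by simpa using h0⟩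
  have hτ' : (τ : ℂ) ≠ 0 := by exact_mod_cast hτ.ne'
  have hr' : ∀ i, (r i : ℂ) ≠ 0 := fun i => by exact_mod_cast (hr i).ne'
  have hwne : w ≠ 0 := by
    rintro rfl
    have : (κ₁ * τ * l : ℂ) ≠ 0 := mul_ne_zero (mul_ne_zero (by exact_mod_cast hκ₁) hτ') hl
    apply this
    linear_combination hw
  have key : ∀ k : ℕ, ∃ y : V → ℂ, (complexSystem G α r τ κ₁ 0 p ^ k)
      (state x (fun i => w * x i / (τ * r i)) 0)
      = state (fun i => (1 + w) ^ k * x i) (fun i => (1 + w) ^ k * (w * x i / (τ * r i))) y := by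
    intro k
    induction k with
    | zero => exact ⟨0, by simp⟩
    | succ k ih =>
      obtain ⟨y, hy⟩ := ih
      have hs : complexLaplacian G α *ᵥ (fun i => (1 + w) ^ k * x i)
          = (1 + w) ^ k • (complexLaplacian G α *ᵥ x) := by
        rw [← mulVec_smul]
        rfl
      rw [pow_succ', Module.End.mul_apply, hy, complexSystem_state]
      refine ⟨_, state_inj.2 ⟨funext fun i => ?_, funext fun i => ?_, rfl⟩⟩
      · have := hr' i
        field_simp
        ring
      · have h3 := hLx i
        have := hr' i
        simp only [hs, Pi.smul_apply, smul_eq_mul, Complex.ofReal_zero]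
        field_simp
        linear_combination (1 + w) ^ k * (-(κ₁ * τ : ℂ) * h3 - x i * hw)
  refine hx0 (h.eq_zero_of_geometric (μ := 1 + w)
    (v := state x (fun i => w * x i / (τ * r i)) 0) (by simpa using hwne) ?_ fun k i => ?_)
  · refine le_trans ?_ (Complex.re_le_norm _)
    simpa using hw0
  · obtain ⟨y, hy⟩ := key k
    exact congrFun hy (.inl i)

/-- The clocks of an eigenvector with `μ ≠ 1` and `|μ| ≥ 1` vanish, as they evolve geometrically; since `κ₂ ≠ 0`, so do
its other components. -/
lemma Synchronizes.norm_eigenvalue_lt_one [Nontrivial V] (hG : ∀ i, ¬ G.Adj i i)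
    (hα : ∀ i j, G.Adj i j → 0 < α i j) (hr : ∀ i, 0 < r i) (hτ : 0 < τ)
    (h : Synchronizes G α r t₀ τ κ₁ κ₂ p) {μ : ℂ}
    (hμ : Module.End.HasEigenvalue (complexSystem G α r τ κ₁ κ₂ p) μ) (h1 : μ ≠ 1) : ‖μ‖ < 1 := by
  by_contra! hge
  obtain ⟨v, hv⟩ := hμ.exists_hasEigenvector
  obtain ⟨x, s, y, rfl⟩ := exists_eq_state v
  have hx : x = 0 := h.eq_zero_of_geometric (μ := μ) h1 hge (v := state x s y) fun k i => by
    rw [hv.pow_apply]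
    rfl
  subst hx
  have heq := hv.apply_eq_smul
  rw [complexSystem_state, mulVec_zero] at heq
  have hs : s = 0 := funext fun i => by
    have := congrFun heq (.inl i)
    have hτ' : (τ : ℂ) ≠ 0 := by exact_mod_cast hτ.ne'
    have hr' : (r i : ℂ) ≠ 0 := by exact_mod_cast (hr i).ne'
    simpa [state, hτ', hr'] using this
  subst hs
  have hy : y = 0 := funext fun i => by
    have := congrFun heq (.inr (.inl i))
    have hκ' : (κ₂ : ℂ) ≠ 0 := by exact_mod_cast h.damping_ne_zero hG hα hr hτ
    simpa [state, hκ'] using this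
  subst hy
  exact hv.2 (by funext a; rcases a with i | i | i <;> rfl)

/-! ### Synchronization from the spectral condition -/

/-- The generalized eigenspace for the eigenvalue `1` is the plane of clocks that agree and run at
the same speed. A longer Jordan chain would put `R⁻¹ 1` into the image of `L`, where it is not,
because its average with respect to `ξ` is positive. -/
lemma eq_of_mem_maxGenEigenspace_one (hG : ∀ i, ¬ G.Adj i i)
    (hα : ∀ i j, G.Adj i j → 0 < α i j) (hc : Connected G) (hr : ∀ i, r i ≠ 0) (hτ : τ ≠ 0)
    (hκ : κ₁ ≠ κ₂) (hp : p ≠ 0) {ξ : V → ℝ} (hξ : ξ ᵥ* laplacian G α = 0)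
    (hγ : ∑ i, ξ i / r i ≠ 0) {v : V ⊕ (V ⊕ V) → ℂ}
    (hv : v ∈ (complexSystem G α r τ κ₁ κ₂ p).maxGenEigenspace 1) :
    ∃ a b : ℂ, v = state (fun _ => a) (fun i => b / r i) 0 := by
  have hτ' : (τ : ℂ) ≠ 0 := by exact_mod_cast hτ
  have hp' : (p : ℂ) ≠ 0 := by exact_mod_cast hp
  have hκ' : (κ₂ - κ₁ : ℂ) ≠ 0 := sub_ne_zero.2 (by exact_mod_cast hκ.symm)
  have hr' : ∀ i, (r i : ℂ) ≠ 0 := fun i => by exact_mod_cast hr i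
  obtain ⟨i₀, hi₀⟩ := hc
  obtain ⟨m, hm⟩ := (Module.End.mem_maxGenEigenspace _ _ _).1 hv
  clear hv
  induction m generalizing v with
  | zero =>
    refine ⟨0, 0, ?_⟩
    have : v = 0 := by simpa using hm
    rw [this]
    funext a
    rcases a with i | i | i <;> simp [state]
  | succ m ih =>
    rw [pow_succ, Module.End.mul_apply] at hm
    obtain ⟨a, b, hab⟩ := ih hm
    obtain ⟨x, s, y, rfl⟩ := exists_eq_state v
    rw [one_smul, LinearMap.sub_apply, complexSystem_state, Module.End.one_apply] at hab
    have e1 : ∀ i, τ * r i * s i = a := fun i => by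
      simpa [state] using congrFun hab (.inl i)
    have e2 : ∀ i, s i - κ₁ * (complexLaplacian G α *ᵥ x) i - κ₂ * y i - s i = b / r i := fun i =>
      congrFun hab (.inr (.inl i))
    have e3 : ∀ i, (1 - p) * y i - p * (complexLaplacian G α *ᵥ x) i - y i = 0 := fun i =>
      congrFun hab (.inr (.inr i))
    have e4 : ∀ i, y i = -(complexLaplacian G α *ᵥ x) i := fun i => by
      refine mul_left_cancel₀ hp' ?_
      linear_combination -e3 i
    have e5 : ∀ i, (κ₂ - κ₁) * (complexLaplacian G α *ᵥ x) i = b / r i := fun i => by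
      have := e2 i
      rw [e4] at this
      linear_combination this
    have hb : b = 0 := by
      have h1 : b * ((∑ i, ξ i / r i : ℝ) : ℂ) = 0 := by
        calc b * ((∑ i, ξ i / r i : ℝ) : ℂ)
            = (κ₂ - κ₁) * ∑ i, (ξ i : ℂ) * (complexLaplacian G α *ᵥ x) i := by
              push_cast
              rw [Finset.mul_sum, Finset.mul_sum]
              refine Finset.sum_congr rfl fun i _ => ?_
              have := e5 i
              linear_combination (-(ξ i : ℂ)) * this
          _ = 0 := by rw [sum_mul_complexLaplacian_mulVec hξ, mul_zero]
      exact (mul_eq_zero.1 h1).resolve_right (by exact_mod_cast hγ)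
    have hLx : complexLaplacian G α *ᵥ x = 0 := funext fun i => by
      have := e5 i
      rw [hb, zero_div] at this
      exact (mul_eq_zero.1 this).resolve_left hκ'
    refine ⟨x i₀, a / τ, state_inj.2 ⟨funext fun i => ?_, funext fun i => ?_, funext fun i => ?_⟩⟩
    · exact eq_of_complexLaplacian_mulVec_eq_zero hG hα ⟨i₀, hi₀⟩ hLx i i₀
    · have := hr' i
      field_simp
      linear_combination e1 i
    · rw [e4, hLx]
      simp

lemma complexSystem_pow_uniform (hG : ∀ i, ¬ G.Adj i i) (hr : ∀ i, r i ≠ 0) (a b : ℂ) (k : ℕ) :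
    (complexSystem G α r τ κ₁ κ₂ p ^ k) (state (fun _ => a) (fun i => b / r i) 0)
      = state (fun _ => a + τ * b * k) (fun i => b / r i) 0 := by
  have hr' : ∀ i, (r i : ℂ) ≠ 0 := fun i => by exact_mod_cast hr i
  induction k with
  | zero => simp
  | succ k ih =>
    rw [pow_succ', Module.End.mul_apply, ih, complexSystem_state,
      complexLaplacian_mulVec_const hG fun _ _ => rfl]
    refine state_inj.2 ⟨funext fun i => ?_, funext fun i => ?_, funext fun i => ?_⟩
    · have := hr' i
      push_cast
      field_simp
      ring
    · simp
    · simp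

/-- The spectral condition makes every complex orbit approach a line in its clocks: split the initial
state along the generalized eigenspaces. -/
lemma exists_tendsto_complexSystem (hG : ∀ i, ¬ G.Adj i i)
    (hα : ∀ i j, G.Adj i j → 0 < α i j) (hc : Connected G) (hr : ∀ i, r i ≠ 0) (hτ : τ ≠ 0)
    (hκ : κ₁ ≠ κ₂) (hp : p ≠ 0) {ξ : V → ℝ} (hξ : ξ ᵥ* laplacian G α = 0)
    (hγ : ∑ i, ξ i / r i ≠ 0)
    (hμ : ∀ μ : ℂ, Module.End.HasEigenvalue (complexSystem G α r τ κ₁ κ₂ p) μ → μ ≠ 1 → ‖μ‖ < 1)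
    (v : V ⊕ (V ⊕ V) → ℂ) :
    ∃ a b : ℂ, ∀ i : V, Tendsto
      (fun k : ℕ => (complexSystem G α r τ κ₁ κ₂ p ^ k) v (.inl i) - a * k) atTop (𝓝 b) := by
  set f := complexSystem G α r τ κ₁ κ₂ p with hf
  have hv : v ∈ ⨆ μ : ℂ, f.maxGenEigenspace μ := by
    rw [Module.End.iSup_maxGenEigenspace_eq_top]
    trivial
  have hzero : ∃ a b : ℂ, ∀ i : V, Tendsto
      (fun k : ℕ => (f ^ k) 0 (.inl i) - a * k) atTop (𝓝 b) := ⟨0, 0, fun i => by simp⟩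
  refine Submodule.iSup_induction _ (motive := fun u => ∃ a b : ℂ, ∀ i : V, Tendsto
    (fun k : ℕ => (f ^ k) u (.inl i) - a * k) atTop (𝓝 b)) hv (fun μ u hu => ?_) hzero ?_
  · by_cases hu0 : u = 0
    · rw [hu0]
      exact hzero
    by_cases h1 : μ = 1
    · subst h1
      obtain ⟨a, b, rfl⟩ := eq_of_mem_maxGenEigenspace_one hG hα hc hr hτ hκ hp hξ hγ hu
      refine ⟨τ * b, a, fun i => ?_⟩
      simp only [hf, complexSystem_pow_uniform hG hr]
      simp [state]
    · have hlt : ‖μ‖ < 1 := by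
        refine hμ μ (Module.End.HasUnifEigenvalue.lt (k := ⊤) one_pos fun hbot => hu0 ?_) h1
        exact (Submodule.mem_bot ℂ).1 (hbot ▸ hu)
      refine ⟨0, 0, fun i => ?_⟩
      have := tendsto_pi_nhds.1 (tendsto_pow_apply_of_norm_lt_one f hlt hu) (.inl i)
      simpa using this
  · rintro u u' ⟨a, b, hab⟩ ⟨a', b', hab'⟩
    refine ⟨a + a', b + b', fun i => ((hab i).add (hab' i)).congr fun k => ?_⟩
    rw [map_add, Pi.add_apply]
    ring

lemma synchronizes_of_spectrum (hG : ∀ i, ¬ G.Adj i i)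
    (hα : ∀ i j, G.Adj i j → 0 < α i j) (hc : Connected G) (hr : ∀ i, r i ≠ 0) (hτ : τ ≠ 0)
    (hκ : κ₁ ≠ κ₂) (hp : p ≠ 0) {ξ : V → ℝ} (hξ : ξ ᵥ* laplacian G α = 0)
    (hγ : ∑ i, ξ i / r i ≠ 0)
    (hμ : ∀ μ : ℂ, Module.End.HasEigenvalue (complexSystem G α r τ κ₁ κ₂ p) μ → μ ≠ 1 → ‖μ‖ < 1) :
    Synchronizes G α r t₀ τ κ₁ κ₂ p := by
  intro z hz
  obtain ⟨a, b, hab⟩ :=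
    exists_tendsto_complexSystem hG hα hc hr hτ hκ hp hξ hγ hμ fun c => (z 0 c : ℂ)
  have horbit : ∀ k : ℕ, (complexSystem G α r τ κ₁ κ₂ p ^ k) (fun c => (z 0 c : ℂ))
      = fun c => (z k c : ℂ) := by
    intro k
    induction k with
    | zero => simp
    | succ k ih =>
      rw [pow_succ', Module.End.mul_apply, ih, complexSystem, Matrix.toLin'_apply,
        map_ofReal_mulVec_ofReal, ← hz k]
  refine ⟨a.re / τ, b.re, fun i => ?_⟩
  refine ((Complex.continuous_re.tendsto _).comp (hab i)).congr fun k => ?_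
  simp only [Function.comp_apply, horbit, clock, time, Complex.sub_re, Complex.ofReal_re,
    Complex.mul_re, Complex.natCast_re, Complex.natCast_im, mul_zero, sub_zero]
  field_simp
  ring

end ComplexSystem

end ClockSync

theorem theorem1 {V : Type*} [Fintype V] [DecidableEq V] [Nontrivial V]
    (G : Digraph V) (hG : ∀ i, ¬ G.Adj i i)
    (α : V → V → ℝ) (hα : ∀ i j, G.Adj i j → 0 < α i j)
    (r : V → ℝ) (hr : ∀ i, 0 < r i)
    (t₀ τ κ₁ κ₂ p : ℝ) (hτ : 0 < τ) :
    (ClockSync.Synchronizes G α r t₀ τ κ₁ κ₂ p ↔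
      ClockSync.Connected G ∧ κ₁ ≠ κ₂ ∧ 0 < p ∧
        ∀ μ : ℂ, Module.End.HasEigenvalue
          (Matrix.toLin' ((ClockSync.systemMatrix G α r τ κ₁ κ₂ p).map Complex.ofReal)) μ →
          μ ≠ 1 → ‖μ‖ < 1) ∧
    (ClockSync.Synchronizes G α r t₀ τ κ₁ κ₂ p →
      ∃ ξ : V → ℝ,
        (∀ w : V → ℝ, (w ᵥ* ClockSync.laplacian G α = 0 ∧ ∑ i, w i = 1) ↔ w = ξ) ∧
        (∀ i, 0 ≤ ξ i) ∧ 0 < ∑ i, ξ i / r i ∧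
        ∀ z : ℕ → V ⊕ (V ⊕ V) → ℝ, ClockSync.IsTrajectory G α r τ κ₁ κ₂ p z →
          ∀ rs xs : ℝ, ClockSync.SynchronizesTo t₀ τ z rs xs ↔
            xs = ClockSync.harmonicMean ξ r *
                ∑ i, ξ i * (1 / r i * ClockSync.clock (z 0) i
                  + τ * (κ₂ / p ^ 2) * ClockSync.avg (z 0) i) ∧
            rs = ClockSync.harmonicMean ξ r *
                ∑ i, ξ i * (ClockSync.skew (z 0) i - κ₂ / p * ClockSync.avg (z 0) i)) := by
  have hr' : ∀ i, r i ≠ 0 := fun i => (hr i).ne'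
  have hp : ClockSync.Synchronizes G α r t₀ τ κ₁ κ₂ p → |1 - p| < 1 := fun h => by
    obtain ⟨ξ, hξ, -⟩ := ClockSync.exists_unique_left_null_vector hG hα (h.connected hG)
    obtain ⟨h1, h2⟩ := (hξ ξ).2 rfl
    exact h.abs_one_sub_lt_one hG hr' hτ.ne' (h.damping_ne_zero hG hα hr hτ) h1 h2
  refine ⟨⟨fun h => ⟨h.connected hG, h.ne hG, ?_, fun μ hμ h1 =>
    h.norm_eigenvalue_lt_one hG hα hr hτ hμ h1⟩, ?_⟩, fun h => ?_⟩
  · linarith [(abs_lt.1 (hp h)).2]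
  · rintro ⟨hc, hκ, hp0, hμ⟩
    obtain ⟨ξ, hξ, hξ0⟩ := ClockSync.exists_unique_left_null_vector hG hα hc
    obtain ⟨h1, h2⟩ := (hξ ξ).2 rfl
    exact ClockSync.synchronizes_of_spectrum hG hα hc hr' hτ.ne' hκ hp0.ne' h1
      (ClockSync.sum_div_pos hξ0 h2 hr).ne' hμ
  · obtain ⟨ξ, hξ, hξ0⟩ := ClockSync.exists_unique_left_null_vector hG hα (h.connected hG)
    obtain ⟨h1, h2⟩ := (hξ ξ).2 rfl
    have hγ := ClockSync.sum_div_pos hξ0 h2 hr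
    have hp0 : p ≠ 0 := by
      rintro rfl
      simpa using hp h
    refine ⟨ξ, hξ, hξ0, hγ, fun z hz rs xs =>
      ⟨fun hs => hs.eq hG hr' hτ.ne' hp0 (hp h) hz h1 hγ.ne', ?_⟩⟩
    rintro ⟨rfl, rfl⟩
    obtain ⟨rs, xs, hs⟩ := h z hz
    obtain ⟨e1, e2⟩ := hs.eq hG hr' hτ.ne' hp0 (hp h) hz h1 hγ.ne'
    rwa [e1, e2] at hs
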